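/- **Setting.** Let a deterministic machine on input $x$ halt after exactly $T=(2^n-1)S$ steps with output $f(x)$, where $S\ge 1$, $n\ge 0$, and every configuration (complete instantaneous description) on the way fits into $S$ bits. Consider simulations of this irreversible computation by checkpoints, i.e. by the reversible pebble game with erasures. At each time the simulator stores a finite set of configurations (checkpoints), each in a register of $S$ bits; it starts with none stored, while the initial configuration on input $x$ is permanently present and is not counted. In one move the simulator may * *place*: store a configuration $d$ not yet present, if the configuration from which the machine reaches $d$ in $S$ steps is present; * *cancel*: remove a stored configuration $d$, if the configuration from which the machine reaches $d$ in $S$ steps is present (other than through the removed register itself); * *erase*: remove any stored configuration; this irreversibly erases $S$ bits. (Node $i$ of the pebble game is pebbled when the configuration after $iS$ steps is stored.) The simulation uses space $S'$ if at all times the number of stored checkpoints times $S$ is at most $S'$. It computes $y=\langle x,f(x)\rangle$ if it ends with a halting configuration with output $f(x)$ present, besides $x$. Let $B^{S'}(x,y)\in\mathbb N\cup\{\infty\}$, the *irreversible simulation cost*, be the least total number of irreversibly erased bits over all such simulations from $x$ to $y$ that use space $S'$ ($\infty$ if there are none). **Corollary (Space-Irreversibility Trade-off).** With $y=\langle x,f(x)\rangle$,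 (i) $B^{(n-k)S}(x,y)\le B^{nS}(x,y)+(2^{k+2}-1)S$ for all $k\ge 1$ with $n\ge k+2$; (ii) $B^{(n-1)S}(x,y)>B^{nS}(x,y)$ if $n\ge 1$. -/

import Mathlib

/-- A deterministic, not necessarily reversible, machine with inputs in `X` and outputs in `Y`.
Its configurations (complete instantaneous descriptions: tape contents, head positions and state)
form the type `σ`; `step c = none` means that `c` is a halting configuration. `encode` writes a
configuration as a string of bits. Turing machines are the main example. -/
structure Machine (σ X Y : Type*) where
  init : X → σ
  step : σ → Option σ
  output : σ → Y
  encode : σ → List Bool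
  encode_injective : Function.Injective encode

namespace Machine

variable {σ X Y : Type*}

/-- The configuration reached from `c` in exactly `t` steps, if the machine does not halt
earlier. -/
def stepN (M : Machine σ X Y) : ℕ → σ → Option σ
  | 0, c => some c
  | t + 1, c => (M.step c).bind (M.stepN t)

/-- On input `x` the machine halts after exactly `T` steps with output `f x`, and every
configuration on the way is written in at most `S` bits. -/
def ComputesUsing (M : Machine σ X Y) (f : X → Y) (x : X) (T S : ℕ) : Prop :=
  (∃ c, M.stepN T (M.init x) = some c ∧ M.step c = none ∧ M.output c = f x) ∧
    ∀ t ≤ T, ∀ c, M.stepN t (M.init x) = some c → (M.encode c).length ≤ S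

open Classical in
/-- One move of a simulation of `M` on input `x` by checkpoints, with segments of `S` steps and
checkpoint registers of `S` bits. `Move M S x C C' b`: the set of stored checkpoints changes from
`C` to `C'`, and `b` bits are irreversibly erased. Besides the stored checkpoints, the initial
configuration is permanently present (it is the fixed pebble on node `0`; a pebble on node `i` is
the presence in `C` of the configuration after `i * S` steps). -/
inductive Move (M : Machine σ X Y) (S : ℕ) (x : X) : Finset σ → Finset σ → ℕ → Prop
  /-- Placing a pebble: recompute the segment from a present `p` to `d`, and store `d`. -/
  | place {C : Finset σ} {p d : σ} (hp : p ∈ insert (M.init x) C) (hpd : M.stepN S p = some d)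
      (hd : d ∉ insert (M.init x) C) : Move M S x C (insert d C) 0
  /-- Reversible removal of a pebble: recompute `d` from a present `p`, and cancel it. -/
  | cancel {C : Finset σ} {p d : σ} (hp : p ∈ insert (M.init x) (C.erase d))
      (hpd : M.stepN S p = some d) (hd : d ∈ C) : Move M S x C (C.erase d) 0
  /-- Irreversible removal of a pebble: erase the register holding `d`. -/
  | erase {C : Finset σ} {d : σ} (hd : d ∈ C) : Move M S x C (C.erase d) S

/-- `Simulates M S x S' C e`: some finite sequence of moves that starts without stored checkpoints
and never uses more than `S'` bits for stored checkpoints ends with the stored checkpoints `C`,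
having irreversibly erased `e` bits in total. -/
inductive Simulates (M : Machine σ X Y) (S : ℕ) (x : X) (S' : ℕ) : Finset σ → ℕ → Prop
  | start : Simulates M S x S' ∅ 0
  | move {C C' : Finset σ} {e b : ℕ} (h : Simulates M S x S' C e) (hm : Move M S x C C' b)
      (hs : C'.card * S ≤ S') : Simulates M S x S' C' (e + b)

open Classical in
/-- With the checkpoints `C` stored, the pair `y` is available: its first component is the input
and its second one is the output of a halting configuration that is present. -/
def Holds (M : Machine σ X Y) (x : X) (C : Finset σ) (y : X × Y) : Prop :=
  y.1 = x ∧ ∃ d ∈ insert (M.init x) C, M.step d = none ∧ M.output d = y.2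

/-- The irreversible simulation cost `B^{S'}(x, y)`: the least number of bits that are
irreversibly erased in a simulation from `x` to `y` that uses at most `S'` bits of storage; it is
`⊤` if there is no such simulation. -/
noncomputable def irrevCost (M : Machine σ X Y) (S S' : ℕ) (x : X) (y : X × Y) : ℕ∞ :=
  sInf {b : ℕ∞ | ∃ (C : Finset σ) (e : ℕ), M.Simulates S x S' C e ∧ M.Holds x C y ∧ b = e}

end Machine

/-! The computation is a chain of `2 ^ n - 1` segments. With `n` registers it costs nothing: a
checkpoint is left `2 ^ (n - 1)` segments ahead, and the other `n - 1` registers recurse beyond it.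
Without erasures, `m` registers never reach node `2 ^ m` (`lt_of_reach`), so `n - 1` registers have
positive cost, which gives (ii). For (i), write `n - k = q + 2`. A checkpoint reaches node `2 ^ (q +
1)` reversibly; each erasure then lets it advance by `2 ^ q` (`simulates_singleton`), and the final
`2 ^ (q + 1) - 1` segments are again free. This takes `2 ^ (k + 2) - 4` erasures. -/

namespace ReversiblePebbling

/-! ### Reach of the reversible pebble game -/

/-- One move of the reversible pebble game on the naturals, with a permanent pebble on `b` and at
most `m` further pebbles: the node `i + 1` may change while `i` is pebbled. -/
def Toggle (b m : ℕ) (P Q : Finset ℕ) : Prop :=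
  P.card ≤ m ∧ Q.card ≤ m ∧
    ∃ i, b ≤ i ∧ (i = b ∨ i ∈ P) ∧ ∀ j, j ≠ i + 1 → (j ∈ P ↔ j ∈ Q)

/-- Reachability in the reversible pebble game. -/
def Reach (b m : ℕ) : Finset ℕ → Finset ℕ → Prop :=
  Relation.ReflTransGen (Toggle b m)

theorem Toggle.symm {b m : ℕ} {P Q : Finset ℕ} (h : Toggle b m P Q) : Toggle b m Q P := by
  obtain ⟨hP, hQ, i, hbi, hi, hPQ⟩ := h
  refine ⟨hQ, hP, i, hbi, ?_, fun j hj => (hPQ j hj).symm⟩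
  rwa [← hPQ i (by omega)]

theorem Reach.symm {b m : ℕ} {P Q : Finset ℕ} (h : Reach b m P Q) : Reach b m Q P :=
  haveI : Std.Symm (Toggle b m) := ⟨fun _ _ => Toggle.symm⟩
  Relation.ReflTransGen.stdSymm.symm _ _ h

theorem card_split (f : ℕ) (P : Finset ℕ) :
    (P.filter (· ≤ f)).card + (P.filter (f < ·)).card = P.card := by
  simpa only [not_le] using P.card_filter_add_card_filter_not (· ≤ f)

/-- If `m` pebbles never get to the node `f`, then, in a game with `m + 1` pebbles, the pebbles
beyond `f` play a game with base `f` and `m` pebbles, and the other ones always form a position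
that is connected to one in which `f` is pebbled. -/
theorem reach_split {b m f : ℕ} (hbf : b < f)
    (hf : ∀ P, Reach b m ∅ P → f ∉ P) {P : Finset ℕ} (h : Reach b (m + 1) ∅ P) :
    P.filter (f < ·) = ∅ ∨ Reach f m ∅ (P.filter (f < ·)) ∧
      ∃ L, f ∈ L ∧ Reach b m L (P.filter (· ≤ f)) := by
  induction h with
  | refl => simp
  | @tail P Q _ hPQ ih =>
    obtain ⟨hP, hQ, i, hbi, hi, hiff⟩ := hPQ
    have cP := card_split f P
    have cQ := card_split f Q
    by_cases hQU : Q.filter (f < ·) = ∅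
    · exact Or.inl hQU
    -- A pebble beyond `f` leaves at most `m` for the lower part.
    have hQU' := Finset.card_pos.2 (Finset.nonempty_iff_ne_empty.2 hQU)
    right
    rcases lt_or_ge i f with hif | hif
    · have hU : P.filter (f < ·) = Q.filter (f < ·) := by
        ext j
        simp only [Finset.mem_filter]
        have := hiff j
        grind
      rw [hU] at ih cP
      obtain ⟨h1, L, hL, h2⟩ := ih.resolve_left hQU
      refine ⟨h1, L, hL, h2.tail ⟨by omega, by omega, i, hbi, ?_, ?_⟩⟩
      · simp only [Finset.mem_filter]
        grind
      · intro j hj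
        simp only [Finset.mem_filter, hiff j hj]
    · have hL : P.filter (· ≤ f) = Q.filter (· ≤ f) := by
        ext j
        simp only [Finset.mem_filter]
        have := hiff j
        grind
      have key : 0 < (Q.filter (· ≤ f)).card → Reach f m ∅ (P.filter (f < ·)) →
          Reach f m ∅ (Q.filter (f < ·)) := by
        intro hpos hr
        rw [hL] at cP
        refine hr.tail ⟨by omega, by omega, i, hif, ?_, ?_⟩
        · simp only [Finset.mem_filter]
          grind
        · intro j hj
          simp only [Finset.mem_filter, hiff j hj]
      rcases ih with hPU | ⟨h1, L, hfL, h2⟩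
      · have hfi : i = f := by
          by_contra hne
          have : i ∈ P.filter (f < ·) := by
            simp only [Finset.mem_filter]
            grind
          simp [hPU] at this
        have hfP : f ∈ P.filter (· ≤ f) := by
          simp only [Finset.mem_filter]
          grind
        refine ⟨key ?_ ?_, P.filter (· ≤ f), hfP, ?_⟩
        · rw [← hL]
          exact Finset.card_pos.2 ⟨f, hfP⟩
        · rw [hPU]
          exact Relation.ReflTransGen.refl
        · rw [hL]
          exact Relation.ReflTransGen.refl
      -- An empty lower part would be connected to `L` with `m` pebbles, so by reversibility `f`
      -- would be reachable. Hence a pebble stays below, and the upper part has at most `m`.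
      · rw [hL] at h2
        refine ⟨key ?_ h1, L, hfL, h2⟩
        rw [Finset.card_pos, Finset.nonempty_iff_ne_empty]
        intro h0
        rw [h0] at h2
        exact hf L h2.symm hfL

/-- The reversible pebble game with `m` pebbles stays below distance `2 ^ m` from its base. -/
theorem lt_of_reach (m : ℕ) : ∀ (b : ℕ) (P : Finset ℕ), Reach b m ∅ P → ∀ j ∈ P, j < b + 2 ^ m := by
  induction m with
  | zero =>
    intro b P h j hj
    rcases Relation.ReflTransGen.cases_tail h with h0 | ⟨_, _, _, h0, _⟩
    · simp [h0] at hj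
    · simp [Finset.card_eq_zero.1 (Nat.le_zero.1 h0)] at hj
  | succ m ih =>
    intro b P h j hj
    have hpos : 0 < 2 ^ m := by positivity
    have hpow : 2 ^ (m + 1) = 2 ^ m + 2 ^ m := by ring
    by_contra! hlt
    have hjU : j ∈ P.filter (b + 2 ^ m < ·) := by
      simp only [Finset.mem_filter]
      exact ⟨hj, by omega⟩
    rcases reach_split (f := b + 2 ^ m) (by omega)
      (fun P hP hmem => lt_irrefl _ (ih b P hP _ hmem)) h with h0 | ⟨h1, -⟩
    · simp [h0] at hjU
    · have := ih _ _ h1 j hjU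
      omega

end ReversiblePebbling

/-! ### Segments of a halting computation -/

namespace Machine

variable {σ X Y : Type*}

theorem stepN_add (M : Machine σ X Y) (a b : ℕ) (d : σ) :
    M.stepN (a + b) d = (M.stepN a d).bind (M.stepN b) := by
  induction a generalizing d with
  | zero => simp [stepN]
  | succ a ih =>
    rw [Nat.succ_add]
    simp only [stepN]
    cases M.step d with
    | none => rfl
    | some e => exact ih e

theorem stepN_eq_none_of_halt (M : Machine σ X Y) {t : ℕ} (ht : 1 ≤ t) {d : σ}
    (hd : M.step d = none) : M.stepN t d = none := by
  obtain ⟨t, rfl⟩ := Nat.exists_eq_add_of_le' ht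
  simp [stepN, hd]

theorem halting_time_unique (M : Machine σ X Y) {s t : ℕ} {c d e : σ}
    (hd : M.stepN s c = some d) (hd' : M.step d = none)
    (he : M.stepN t c = some e) (he' : M.step e = none) : s = t := by
  have key : ∀ {s t : ℕ} {d e : σ}, M.stepN s c = some d → M.step d = none →
      M.stepN t c = some e → ¬ s < t := by
    intro s t d e hd hd' he hlt
    have h := M.stepN_add s (t - s) c
    rw [Nat.add_sub_cancel' hlt.le, he, hd, Option.bind_some,
      M.stepN_eq_none_of_halt (by omega) hd'] at h
    cases h
  have h1 := key hd hd' he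
  have h2 := key he he' hd
  omega

/-- `c 0, …, c N` are the configurations of a halting computation at the multiples of `S`. -/
structure IsChain (M : Machine σ X Y) (S : ℕ) (x : X) (N : ℕ) (c : ℕ → σ) : Prop where
  zero : c 0 = M.init x
  next : ∀ i < N, M.stepN S (c i) = some (c (i + 1))
  last : M.stepN S (c N) = none
  inj : ∀ i ≤ N, ∀ j ≤ N, c i = c j → i = j
  halt_iff : ∀ i ≤ N, (M.step (c i) = none ↔ i = N)

theorem ComputesUsing.exists_isChain {M : Machine σ X Y} {f : X → Y} {x : X} {N S : ℕ}
    (hS : 1 ≤ S) (h : M.ComputesUsing f x (N * S) S) :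
    ∃ c, M.IsChain S x N c ∧ M.output (c N) = f x := by
  obtain ⟨⟨e, he, he', hout⟩, -⟩ := h
  have hex : ∀ i ≤ N, ∃ d, M.stepN (i * S) (M.init x) = some d ∧
      M.stepN ((N - i) * S) d = some e := by
    intro i hi
    rw [show N * S = i * S + (N - i) * S by rw [← add_mul, Nat.add_sub_cancel' hi],
      stepN_add] at he
    exact Option.bind_eq_some_iff.1 he
  have : Nonempty σ := ⟨M.init x⟩
  choose! c hc hce using hex
  have hcN : c N = e := by simpa [he] using (hc N le_rfl).symm
  refine ⟨c, ⟨?_, ?_, ?_, ?_, ?_⟩, hcN ▸ hout⟩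
  · simpa [stepN] using (hc 0 (Nat.zero_le _)).symm
  · intro i hi
    have h := hc (i + 1) hi
    rwa [add_mul, one_mul, stepN_add, hc i hi.le, Option.bind_some] at h
  · exact M.stepN_eq_none_of_halt hS (hcN ▸ he')
  -- The remaining time to halting determines the index.
  · intro i hi j hj hij
    have h := M.halting_time_unique (hce i hi) he' (hij ▸ hce j hj) he'
    have := Nat.eq_of_mul_eq_mul_right hS h
    omega
  · intro i hi
    refine ⟨fun h => ?_, fun h => by rw [h, hcN, he']⟩
    have h := M.halting_time_unique (hce i hi) he' (t := 0) rfl h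
    rcases Nat.mul_eq_zero.1 h with h | h <;> omega

/-! ### Simulations along the chain -/

section Chain

variable {M : Machine σ X Y} {S : ℕ} {x : X} {N : ℕ} {c : ℕ → σ}

open Classical in
-- Placing and cancelling are mutually inverse and free. The equivalence lets later constructions be
-- run backwards.
theorem IsChain.simulates_insert_succ (hc : M.IsChain S x N c) {S' i : ℕ} {C : Finset σ}
    (hi : i < N) (hiC : c i ∈ insert (M.init x) C) (hfresh : c (i + 1) ∉ insert (M.init x) C)
    (hcard : (C.card + 1) * S ≤ S') (e : ℕ) :
    M.Simulates S x S' C e ↔ M.Simulates S x S' (insert (c (i + 1)) C) e := by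
  have hC : c (i + 1) ∉ C := fun h => hfresh (Finset.mem_insert_of_mem h)
  constructor
  · intro h
    refine h.move (b := 0) (Move.place hiC (hc.next i hi) hfresh) ?_
    rwa [Finset.card_insert_of_notMem hC]
  · intro h
    have hm := Move.cancel (M := M) (S := S) (x := x) (C := insert (c (i + 1)) C) (p := c i)
      (by rwa [Finset.erase_insert hC]) (hc.next i hi) (Finset.mem_insert_self _ _)
    rw [Finset.erase_insert hC] at hm
    exact h.move hm ((Nat.mul_le_mul_right S (Nat.le_succ _)).trans hcard)

open Classical in
/-- With `m + 1` free registers a checkpoint is carried over `2 ^ m` segments, reversibly. -/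
theorem IsChain.simulates_insert_add_two_pow (hc : M.IsChain S x N c) {S' : ℕ} (e m : ℕ) :
    ∀ {i : ℕ} {C : Finset σ}, i + 2 ^ m ≤ N → c i ∈ insert (M.init x) C →
      (∀ j, i < j → j ≤ i + 2 ^ m → c j ∉ insert (M.init x) C) →
      (C.card + (m + 1)) * S ≤ S' →
      (M.Simulates S x S' C e ↔ M.Simulates S x S' (insert (c (i + 2 ^ m)) C) e) := by
  induction m with
  | zero =>
    intro i C hi hiC hfresh hcard
    exact hc.simulates_insert_succ hi hiC (hfresh _ (by omega) le_rfl) hcard e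
  | succ m ih =>
    intro i C hi hiC hfresh hcard
    have hpos : 0 < 2 ^ m := by positivity
    have hpow : 2 ^ (m + 1) = 2 ^ m + 2 ^ m := by ring
    rw [hpow, ← add_assoc] at hi hfresh ⊢
    have hne : ∀ {j l}, j ≤ N → l ≤ N → j ≠ l → c j ≠ c l :=
      fun hj hl hjl h => hjl (hc.inj _ hj _ hl h)
    have hcard1 : ∀ d : σ, ((insert d C).card + (m + 1)) * S ≤ S' := fun d =>
      (Nat.mul_le_mul_right S (by have := Finset.card_insert_le d C; omega)).trans hcard
    -- Carry to the midpoint, carry on from there, then uncompute the midpoint by the reversed first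
    -- half.
    rw [ih (C := C) (i := i) (by omega) hiC (fun j h1 h2 => hfresh j h1 (by omega))
        ((Nat.mul_le_mul_right S (by omega)).trans hcard),
      ih (C := insert (c (i + 2 ^ m)) C) (i := i + 2 ^ m) hi (by simp) ?_ (hcard1 _),
      Finset.insert_comm, ← ih (C := insert (c (i + 2 ^ m + 2 ^ m)) C) (i := i) (by omega) ?_ ?_
        (hcard1 _)]
    · rw [Finset.insert_comm]
      exact Finset.mem_insert_of_mem hiC
    · intro j h1 h2
      rw [Finset.insert_comm, Finset.mem_insert, not_or]
      exact ⟨hne (by omega) hi (by omega), hfresh j h1 (by omega)⟩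
    · intro j h1 h2
      rw [Finset.insert_comm, Finset.mem_insert, not_or]
      exact ⟨hne (by omega) (by omega) (by omega), hfresh j (by omega) h2⟩

open Classical in
/-- With `m` free registers the next `2 ^ m - 1` segments are simulated reversibly. -/
theorem IsChain.exists_simulates_add_two_pow_sub_one (hc : M.IsChain S x N c) {S' : ℕ} (e m : ℕ) :
    ∀ {i : ℕ} {C : Finset σ}, i + 2 ^ m ≤ N + 1 → c i ∈ insert (M.init x) C →
      (∀ j, i < j → j ≤ N → c j ∉ insert (M.init x) C) → (C.card + m) * S ≤ S' →
      M.Simulates S x S' C e →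
      ∃ C', M.Simulates S x S' C' e ∧ c (i + 2 ^ m - 1) ∈ insert (M.init x) C' := by
  induction m with
  | zero => exact fun {i C} _ hiC _ _ h => ⟨C, h, hiC⟩
  | succ m ih =>
    intro i C hi hiC hfresh hcard h
    have hpos : 0 < 2 ^ m := by positivity
    have hpow : 2 ^ (m + 1) = 2 ^ m + 2 ^ m := by ring
    rw [hpow, ← add_assoc] at hi ⊢
    -- The midpoint checkpoint is never removed, so `m` registers remain for the second half.
    refine ih (i := i + 2 ^ m) (C := insert (c (i + 2 ^ m)) C) hi (by simp) ?_ ?_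
      ((hc.simulates_insert_add_two_pow e m (by omega) hiC
        (fun j h1 h2 => hfresh j h1 (by omega)) hcard).1 h)
    · intro j h1 h2
      rw [Finset.insert_comm, Finset.mem_insert, not_or]
      refine ⟨fun h => ?_, hfresh j (by omega) h2⟩
      have := hc.inj _ h2 _ (by omega) h
      omega
    · exact (Nat.mul_le_mul_right S (by
        have := Finset.card_insert_le (c (i + 2 ^ m)) C; omega)).trans hcard

open Classical in
theorem IsChain.notMem_insert_init (hc : M.IsChain S x N c) {i : ℕ} (hi : i ≤ N) (h0 : 1 ≤ i)
    {C : Finset σ} (hC : c i ∉ C) : c i ∉ insert (M.init x) C := by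
  rw [Finset.mem_insert, not_or]
  refine ⟨fun h => ?_, hC⟩
  have := hc.inj _ hi 0 (Nat.zero_le _) (h.trans hc.zero.symm)
  omega

open Classical in
/-- With `q + 2` registers, each erasure moves a single checkpoint by `2 ^ q` segments. -/
theorem IsChain.simulates_singleton (hc : M.IsChain S x N c) (q t : ℕ)
    (ht : 2 ^ (q + 1) + t * 2 ^ q ≤ N) :
    M.Simulates S x ((q + 2) * S) {c (2 ^ (q + 1) + t * 2 ^ q)} (t * S) := by
  induction t with
  | zero =>
    have hpos : 0 < 2 ^ (q + 1) := by positivity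
    have h := (hc.simulates_insert_add_two_pow (S' := (q + 2) * S) (i := 0) (C := ∅) 0 (q + 1)
      (by omega) (by simp [hc.zero])
      (fun j h1 h2 => hc.notMem_insert_init (by omega) h1 (by simp))
      (by simp [add_assoc])).1 Simulates.start
    simpa using h
  | succ t ih =>
    have hpos : 0 < 2 ^ q := by positivity
    rw [add_mul t 1 S, one_mul, add_mul t 1, one_mul, ← add_assoc] at *
    set i := 2 ^ (q + 1) + t * 2 ^ q with hidef
    have hlt : ∀ {j l}, j ≤ N → l < j → c j ≠ c l := fun hj hl h =>
      hl.ne' (hc.inj _ hj _ (by omega) h)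
    have h := (hc.simulates_insert_add_two_pow (S' := (q + 2) * S) (i := i) (C := {c i}) (t * S) q
      ht (by simp)
      (fun j h1 h2 => hc.notMem_insert_init (by omega) (by omega)
        (by simpa using hlt (by omega) h1))
      (by simp only [Finset.card_singleton]; exact Nat.mul_le_mul_right S (by omega))).1
        (ih (by omega))
    have hm := Move.erase (M := M) (S := S) (x := x) (C := insert (c (i + 2 ^ q)) {c i})
      (d := c i) (by simp)
    have hne : c (i + 2 ^ q) ≠ c i := hlt ht (by omega)
    rw [Finset.erase_insert_of_ne hne, Finset.erase_singleton, insert_empty_eq] at hm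
    exact h.move hm (by simp only [Finset.card_singleton]; exact Nat.mul_le_mul_right S (by omega))

open Classical in
theorem IsChain.irrevCost_le (hc : M.IsChain S x N c) {S' e : ℕ} {C : Finset σ}
    (h : M.Simulates S x S' C e) (hN : c N ∈ insert (M.init x) C) :
    M.irrevCost S S' x (x, M.output (c N)) ≤ e :=
  sInf_le ⟨C, e, h, ⟨rfl, c N, hN, (hc.halt_iff N le_rfl).2 rfl, rfl⟩, rfl⟩

open Classical in
/-- In a simulation without erasures the pebbled nodes follow the reversible pebble game. -/
theorem IsChain.reach_of_simulates (hc : M.IsChain S x N c) (hS : 1 ≤ S) {m : ℕ} {C : Finset σ}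
    {e : ℕ} (h : M.Simulates S x (m * S) C e) (he : e = 0) :
    C.card ≤ m ∧ (∀ d ∈ insert (M.init x) C, ∃ i ≤ N, d = c i) ∧
      ReversiblePebbling.Reach 0 m ∅ ((Finset.Icc 1 N).filter (c · ∈ C)) := by
  induction h with
  | start =>
    refine ⟨by simp, ?_, ?_⟩
    · intro d hd
      exact ⟨0, Nat.zero_le _, by simpa [hc.zero] using hd⟩
    · simp only [Finset.notMem_empty, Finset.filter_false]
      exact Relation.ReflTransGen.refl
  | @move C C' e b _ hm hs ih =>
    obtain ⟨hC, hmem, hr⟩ := ih (by omega)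
    have hC' : C'.card ≤ m := Nat.le_of_mul_le_mul_right hs hS
    have hcard : ∀ D : Finset σ, ((Finset.Icc 1 N).filter (c · ∈ D)).card ≤ D.card := by
      intro D
      refine Finset.card_le_card_of_injOn c (fun i hi => (Finset.mem_filter.1 hi).2) ?_
      intro i hi j hj hij
      simp only [Finset.coe_filter, Finset.mem_Icc, Set.mem_ofPred_eq] at hi hj
      exact hc.inj i hi.1.2 j hj.1.2 hij
    -- By determinism, and because nothing follows `c N`, no move recomputes a configuration outside
    -- the chain.
    have hsucc : ∀ {p d : σ}, p ∈ insert (M.init x) C → M.stepN S p = some d →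
        ∃ i < N, p = c i ∧ d = c (i + 1) := by
      intro p d hp hpd
      obtain ⟨i, hi, rfl⟩ := hmem p hp
      rcases hi.eq_or_lt with rfl | hi
      · rw [hc.last] at hpd
        cases hpd
      · rw [hc.next i hi] at hpd
        exact ⟨i, hi, rfl, (Option.some.inj hpd).symm⟩
    have hstep : ∀ i < N, c i ∈ insert (M.init x) C →
        (∀ d, d ≠ c (i + 1) → (d ∈ C ↔ d ∈ C')) →
        ReversiblePebbling.Reach 0 m ∅ ((Finset.Icc 1 N).filter (c · ∈ C')) := by
      intro i hi hiC hiff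
      refine hr.tail ⟨(hcard C).trans hC, (hcard C').trans hC', i, Nat.zero_le _, ?_, ?_⟩
      · rcases Nat.eq_zero_or_pos i with h0 | h0
        · exact Or.inl h0
        · right
          by_contra hcon
          refine hc.notMem_insert_init hi.le h0 (fun hiC' => hcon ?_) hiC
          exact Finset.mem_filter.2 ⟨Finset.mem_Icc.2 ⟨h0, hi.le⟩, hiC'⟩
      · intro j hj
        simp only [Finset.mem_filter, Finset.mem_Icc]
        refine and_congr_right fun hjN => hiff _ fun h => hj ?_
        exact hc.inj j hjN.2 (i + 1) hi h
    cases hm with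
    | @place p d hp hpd hd =>
      obtain ⟨i, hi, rfl, rfl⟩ := hsucc hp hpd
      refine ⟨hC', ?_, hstep i hi hp fun d hd => by simp [hd]⟩
      intro d hd
      rw [Finset.insert_comm, Finset.mem_insert] at hd
      rcases hd with rfl | hd
      · exact ⟨i + 1, hi, rfl⟩
      · exact hmem d hd
    | @cancel p d hp hpd hd =>
      have hsub : insert (M.init x) (C.erase d) ⊆ insert (M.init x) C :=
        Finset.insert_subset_insert _ (Finset.erase_subset _ _)
      obtain ⟨i, hi, rfl, rfl⟩ := hsucc (hsub hp) hpd
      exact ⟨hC', fun d hd => hmem d (hsub hd), hstep i hi (hsub hp) fun d hd => by simp [hd]⟩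
    -- An erasure costs `S ≥ 1` bits, contrary to total cost zero.
    | erase hd => omega

/-- Some bits have to be erased if the chain is too long for the number of registers. -/
theorem IsChain.irrevCost_pos (hc : M.IsChain S x N c) (hS : 1 ≤ S) {m : ℕ} (hm : 2 ^ m ≤ N)
    (y : X × Y) : 0 < M.irrevCost S (m * S) x y := by
  classical
  rw [pos_iff_ne_zero]
  intro h0
  -- An empty set has infimum `⊤`, so cost zero is attained by an actual simulation.
  have hne : {b : ℕ∞ | ∃ (C : Finset σ) (e : ℕ),
      M.Simulates S x (m * S) C e ∧ M.Holds x C y ∧ b = e}.Nonempty := by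
    by_contra hcon
    rw [irrevCost, Set.not_nonempty_iff_eq_empty.1 hcon, sInf_empty] at h0
    exact ENat.top_ne_zero h0
  obtain ⟨C, e, hsim, ⟨-, d, hd, hhalt, -⟩, he⟩ := csInf_mem hne
  rw [← irrevCost, h0] at he
  obtain ⟨-, hmem, hr⟩ := hc.reach_of_simulates hS hsim (by exact_mod_cast he.symm)
  have hpos : 0 < 2 ^ m := by positivity
  rw [Finset.mem_insert] at hd
  obtain ⟨i, hi, rfl⟩ := hmem d (by rw [Finset.mem_insert]; exact hd)
  obtain rfl := (hc.halt_iff i hi).1 hhalt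
  have hiC : c i ∈ C := by
    rcases hd with hd | hd
    · have := hc.inj i le_rfl 0 (Nat.zero_le _) (hd.trans hc.zero.symm)
      omega
    · exact hd
  have := ReversiblePebbling.lt_of_reach m 0 _ hr i (by simp [hiC]; omega)
  omega

end Chain

end Machine

theorem mainTheorem6 {σ X Y : Type*} (M : Machine σ X Y) (f : X → Y) (x : X) (n S : ℕ)
    (hS : 1 ≤ S) (hM : M.ComputesUsing f x ((2 ^ n - 1) * S) S) :
    (∀ k : ℕ, 1 ≤ k → k + 2 ≤ n →
      M.irrevCost S ((n - k) * S) x (x, f x) ≤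
        M.irrevCost S (n * S) x (x, f x) + (((2 ^ (k + 2) - 1) * S : ℕ) : ℕ∞)) ∧
    (1 ≤ n → M.irrevCost S ((n - 1) * S) x (x, f x) > M.irrevCost S (n * S) x (x, f x)) := by
  classical
  obtain ⟨c, hc, hout⟩ := hM.exists_isChain hS
  have hpos : ∀ m : ℕ, 0 < 2 ^ m := fun m => by positivity
  rw [← hout]
  constructor
  · intro k _ hkn
    obtain ⟨q, rfl⟩ := Nat.exists_eq_add_of_le' hkn
    -- The additive term alone is already a sufficient bound.
    refine le_trans ?_ le_add_self
    rw [show q + (k + 2) - k = q + 2 by omega]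
    have hlen : 2 ^ (q + 1) + (2 ^ (k + 2) - 4) * 2 ^ q + 2 ^ (q + 1) = 2 ^ (q + (k + 2)) := by
      have h4 : 4 ≤ 2 ^ (k + 2) := by rw [pow_add]; have := hpos k; omega
      obtain ⟨r, hr⟩ := Nat.exists_eq_add_of_le' h4
      rw [pow_add 2 q (k + 2), hr, Nat.add_sub_cancel, pow_succ]
      ring
    have h1 := hpos (q + 1)
    have hsim := hc.simulates_singleton q (2 ^ (k + 2) - 4) (by omega)
    obtain ⟨C, hC, hN⟩ := hc.exists_simulates_add_two_pow_sub_one _ (q + 1)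
      (i := 2 ^ (q + 1) + (2 ^ (k + 2) - 4) * 2 ^ q) (by omega)
      (by simp) (fun j hj hjN => hc.notMem_insert_init hjN (by omega) (by
        rw [Finset.mem_singleton]
        intro h
        have := hc.inj _ hjN _ (by omega) h
        omega)) (by
          rw [Finset.card_singleton]
          exact Nat.mul_le_mul_right S (by omega)) hsim
    rw [hlen] at hN
    refine (hc.irrevCost_le hC hN).trans ?_
    exact_mod_cast Nat.mul_le_mul_right S (by omega)
  · intro hn
    have h0 := hpos n
    obtain ⟨C, hC, hN⟩ := hc.exists_simulates_add_two_pow_sub_one (S' := n * S) (i := 0) (C := ∅)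
      0 n (by omega) (by simp [hc.zero])
      (fun j hj hjN => hc.notMem_insert_init hjN hj (by simp)) (by simp) Machine.Simulates.start
    rw [Nat.zero_add] at hN
    refine (hc.irrevCost_le hC hN).trans_lt ?_
    obtain ⟨m, rfl⟩ := Nat.exists_eq_add_of_le' hn
    have := hpos m
    rw [Nat.add_sub_cancel, Nat.cast_zero]
    exact hc.irrevCost_pos hS (by rw [pow_succ]; omega) _
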